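/- **Conventions.** $\mathcal F h(\xi)=\int h(x)e^{-2\pi i\,\xi\cdot x}\,dx$ on $L^1\cap L^2$, extended unitarily to $L^2$; $\langle f,g\rangle=\int f\,\overline g$. For $b,t\in\mathbb R$, $a\in\mathbb R^\times=\mathbb R\setminus\{0\}$ let $W_{b,a}\chi(t)=|a|^{-1/2}\chi((t-b)/a)$ and $\mathcal W_\chi h(b,a)=\langle h,W_{b,a}\chi\rangle$. For $b\in\mathbb R^2$, $s\in\mathbb R$, $a\in\mathbb R^\times$ let $$N_s=\begin{pmatrix}1&-s\\0&1\end{pmatrix},\quad A_a=a\begin{pmatrix}1&0\\0&|a|^{-1/2}\end{pmatrix},\quad \tilde N_s=\begin{pmatrix}1&0\\-s&1\end{pmatrix},\quad \tilde A_a=a\begin{pmatrix}|a|^{-1/2}&0\\0&1\end{pmatrix},$$ $S_{b,s,a}\psi(z)=|a|^{-3/4}\psi(A_a^{-1}N_s^{-1}(z-b))$, $S^{\mathbf v}_{b,s,a}\psi(z)=|a|^{-3/4}\psi(\tilde A_a^{-1}\tilde N_s^{-1}(z-b))$, $\mathcal S_\psi f(b,s,a)=\langle f,S_{b,s,a}\psi\rangle$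 and $\mathcal S^{\mathbf v}_\psi f(b,s,a)=\langle f,S^{\mathbf v}_{b,s,a}\psi\rangle$. Let $C=\{|\xi_2/\xi_1|\le1\}$ and $C^{\mathbf v}=\{|\xi_1/\xi_2|\le1\}$ in $\mathbb R^2$, and let $P_C,P_{C^{\mathbf v}}$ be the projections of $L^2(\mathbb R^2)$ with $\mathcal F(P_Df)=\mathbf 1_D\,\mathcal Ff$. For $f\in L^1(\mathbb R^2)$ let $$\mathcal Rf(v,t)=\int_{\mathbb R}f(t-vy,y)\,dy,\qquad \mathcal R^{\mathbf v}f(v,t)=\int_{\mathbb R}f(x,t-vx)\,dx .$$ **Proposition 3.1.** Let $\psi_1,\psi_2\in L^2(\mathbb R)$ and $\psi\in L^2(\mathbb R^2)$ satisfy $\mathcal F\psi(\xi_1,\xi_2)=\mathcal F\psi_1(\xi_1)\,\mathcal F\psi_2(\xi_2/\xi_1)$ for a.e. $\xi$, and $$0<\int_{\mathbb R}\frac{|\mathcal F\psi_1(\tau)|^2}{|\tau|}\,d\tau<\infty,\qquad \int_{\mathbb R}|\tau||\mathcal F\psi_1(\tau)|^2\,d\tau<\infty,\qquad \int_{\mathbb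 R}|\tau|^2|\mathcal F\psi_1(\tau)|^2\,d\tau<\infty .$$ Let $\psi^{\mathbf v}\in L^2(\mathbb R^2)$ be given by $\mathcal F\psi^{\mathbf v}(\xi_1,\xi_2)=\mathcal F\psi(\xi_2,\xi_1)$ and put $\phi_2=\mathcal F\psi_2$. Then there is a (necessarily unique) $\chi_1\in L^2(\mathbb R)$ with $\mathcal F\chi_1(\tau)=|\tau|\,\mathcal F\psi_1(\tau)$ for a.e. $\tau$, and for every $f\in L^1(\mathbb R^2)\cap L^2(\mathbb R^2)$ the functions $\mathcal Rf(v,\cdot)$ and $\mathcal R^{\mathbf v}f(v,\cdot)$ are in $L^2(\mathbb R)$ for a.e. $v$, and for all $x,y,s\in\mathbb R$ and $a\in\mathbb R^\times$, $$\mathcal S_\psi[P_Cf]((x,y),s,a)=|a|^{-3/4}\int_{-1}^1\mathcal W_{\chi_1}(\mathcal Rf(v,\cdot))(x+vy,a)\,\overline{\phi_2\!\left(\frac{v-s}{|a|^{1/2}}\right)}\,dv,$$ $$\mathcal S^{\mathbf v}_{\psi^{\mathbf v}}[P_{C^{\mathbf v}}f]((x,y),s,a)=|a|^{-3/4}\int_{-1}^1\mathcal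 W_{\chi_1}(\mathcal R^{\mathbf v}f(v,\cdot))(vx+y,a)\,\overline{\phi_2\!\left(\frac{v-s}{|a|^{1/2}}\right)}\,dv,$$ where both integrands are integrable on $[-1,1]$. -/

import Mathlib

open MeasureTheory
open scoped FourierTransform ComplexConjugate ENNReal

noncomputable section

namespace ConeShearlet

/-- The plane `ℝ²` with its Euclidean structure and Lebesgue measure. -/
abbrev Plane : Type := EuclideanSpace ℝ (Fin 2)

/-- `L²(ℝ)`. Here `𝓕` is Mathlib's Fourier-Plancherel transform, with kernel
`exp (-2πi ξ x)` on `L¹ ∩ L²`. -/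
abbrev L2Line : Type := Lp ℂ 2 (volume : Measure ℝ)

/-- `L²(ℝ²)`. -/
abbrev L2Plane : Type := Lp ℂ 2 (volume : Measure Plane)

/-- The scalar product of `L²`, linear in the first argument:
`⟨f, g⟩ = ∫ f(x) conj(g(x)) dx`. -/
def scalar {X : Type*} [MeasureSpace X] (f g : X → ℂ) : ℂ :=
  ∫ x, f x * conj (g x)

/-! ### Wavelets -/

/-- `W_{b,a} ψ (x) = |a|^{-1/2} ψ((x - b)/a)`. -/
def waveletAct (b a : ℝ) (ψ : ℝ → ℂ) (x : ℝ) : ℂ :=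
  ((|a| ^ (-(1 / 2) : ℝ) : ℝ) : ℂ) * ψ ((x - b) / a)

/-- The wavelet transform `𝒲_ψ f (b, a) = ⟨f, W_{b,a} ψ⟩`. -/
def waveletTransform (ψ f : ℝ → ℂ) (b a : ℝ) : ℂ :=
  scalar f (waveletAct b a ψ)

/-! ### Shearlets -/

/-- The shear matrix `N_s`. -/
def shearN (s : ℝ) : Matrix (Fin 2) (Fin 2) ℝ := !![1, -s; 0, 1]

/-- The parabolic dilation matrix `A_a`. -/
def dilA (a : ℝ) : Matrix (Fin 2) (Fin 2) ℝ :=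
  a • !![1, 0; 0, |a| ^ (-(1 / 2) : ℝ)]

/-- The vertical shear matrix. -/
def shearNv (s : ℝ) : Matrix (Fin 2) (Fin 2) ℝ := !![1, 0; -s, 1]

/-- The vertical parabolic dilation matrix. -/
def dilAv (a : ℝ) : Matrix (Fin 2) (Fin 2) ℝ :=
  a • !![|a| ^ (-(1 / 2) : ℝ), 0; 0, 1]

/-- `S_{b,s,a} ψ (x) = |a|^{-3/4} ψ(A_a⁻¹ N_s⁻¹ (x - b))`. -/
def shearletAct (b : Plane) (s a : ℝ) (ψ : Plane → ℂ) (x : Plane) : ℂ :=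
  ((|a| ^ (-(3 / 4) : ℝ) : ℝ) : ℂ) *
    ψ (Matrix.toEuclideanLin ((dilA a)⁻¹ * (shearN s)⁻¹) (x - b))

/-- The vertical shearlet representation. -/
def shearletActV (b : Plane) (s a : ℝ) (ψ : Plane → ℂ) (x : Plane) : ℂ :=
  ((|a| ^ (-(3 / 4) : ℝ) : ℝ) : ℂ) *
    ψ (Matrix.toEuclideanLin ((dilAv a)⁻¹ * (shearNv s)⁻¹) (x - b))

/-- The shearlet transform `𝒮_ψ f (b, s, a) = ⟨f, S_{b,s,a} ψ⟩`. -/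
def shearletTransform (ψ f : L2Plane) (b : Plane) (s a : ℝ) : ℂ :=
  scalar f (shearletAct b s a ψ)

/-- The vertical shearlet transform. -/
def shearletTransformV (ψ f : L2Plane) (b : Plane) (s a : ℝ) : ℂ :=
  scalar f (shearletActV b s a ψ)

/-! ### Exchange of the two frequency variables -/

/-- `(ξ₁, ξ₂) ↦ (ξ₂, ξ₁)`. -/
def swapCoord (ξ : Plane) : Plane := !₂[ξ 1, ξ 0]

theorem measurePreserving_swapCoord :
    MeasurePreserving swapCoord (volume : Measure Plane) volume := by
  have h := (LinearIsometryEquiv.piLpCongrLeft 2 ℝ ℝ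
    (Equiv.swap (0 : Fin 2) 1)).measurePreserving
  have e : swapCoord = ⇑(LinearIsometryEquiv.piLpCongrLeft 2 ℝ ℝ
      (Equiv.swap (0 : Fin 2) 1)) := by
    funext ξ
    ext i
    fin_cases i <;>
      simp [swapCoord, LinearIsometryEquiv.piLpCongrLeft_apply, Equiv.piCongrLeft'_apply]
  rw [e]
  exact h

/-- `g ∘ swapCoord` in `L²(ℝ²)`. -/
def swapL2 (g : L2Plane) : L2Plane :=
  ((Lp.memLp g).comp_measurePreserving measurePreserving_swapCoord).toLp (g ∘ swapCoord)

/-- `ψᵛ`, defined by `𝓕 ψᵛ (ξ₁, ξ₂) = 𝓕 ψ (ξ₂, ξ₁)`. -/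
def vert (ψ : L2Plane) : L2Plane := 𝓕⁻ (swapL2 (𝓕 ψ))

/-! ### Frequency cones and projections -/

/-- The horizontal cone `|ξ₂ / ξ₁| ≤ 1`. -/
def coneH : Set Plane := {ξ | ξ 0 ≠ 0 ∧ |ξ 1 / ξ 0| ≤ 1}

/-- The vertical cone `|ξ₁ / ξ₂| ≤ 1`. -/
def coneV : Set Plane := {ξ | ξ 1 ≠ 0 ∧ |ξ 0 / ξ 1| ≤ 1}

theorem measurableSet_coneH : MeasurableSet coneH := by
  have h0 : Measurable fun ξ : Plane => ξ 0 := by fun_prop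
  have h1 : Measurable fun ξ : Plane => ξ 1 := by fun_prop
  exact (h0 (measurableSet_singleton 0).compl).inter
    (measurableSet_le (continuous_abs.measurable.comp (h1.div h0)) measurable_const)

theorem measurableSet_coneV : MeasurableSet coneV := by
  have h0 : Measurable fun ξ : Plane => ξ 0 := by fun_prop
  have h1 : Measurable fun ξ : Plane => ξ 1 := by fun_prop
  exact (h1 (measurableSet_singleton 0).compl).inter
    (measurableSet_le (continuous_abs.measurable.comp (h0.div h1)) measurable_const)

/-- Multiplication by the characteristic function `χ_D` on `L²(ℝ²)`. -/
def cutoff (D : Set Plane) (hD : MeasurableSet D) (g : L2Plane) : L2Plane :=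
  ((Lp.memLp g).indicator hD).toLp (D.indicator g)

/-- The frequency projection onto a measurable set `D`: `𝓕 (P_D f) = χ_D · 𝓕 f`. -/
def freqProj (D : Set Plane) (hD : MeasurableSet D) (f : L2Plane) : L2Plane :=
  𝓕⁻ (cutoff D hD (𝓕 f))

/-- `P_C`. -/
def projH (f : L2Plane) : L2Plane := freqProj coneH measurableSet_coneH f

/-- `P_{Cᵛ}`. -/
def projV (f : L2Plane) : L2Plane := freqProj coneV measurableSet_coneV f

/-! ### Affine Radon transforms -/

/-- The horizontal affine Radon transform `ℛ f (v, t) = ∫ f(t - v y, y) dy`. -/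
def radonH (f : Plane → ℂ) (v t : ℝ) : ℂ := ∫ y : ℝ, f !₂[t - v * y, y]

/-- The vertical affine Radon transform `ℛᵛ f (v, t) = ∫ f(x, t - v x) dx`. -/
def radonV (f : Plane → ℂ) (v t : ℝ) : ℂ := ∫ x : ℝ, f !₂[x, t - v * x]

end ConeShearlet

end

/-! By Parseval the shearlet coefficient of `P_C f` is a frequency integral, and the coordinates ξ =
(τ, vτ), with Jacobian |τ|, turn the cone into v ∈ [-1, 1]. Each factor then has a one-dimensional
meaning. By the slice theorem (`fourier_radonH`), 𝓕f(τ, vτ) is the transform of ℛf(v, ·) at τ. The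
transform of the moved shearlet splits (`fourier_movedShearlet`) into a phase of frequency x + vy,
the factor 𝓕ψ₁(aτ), and a factor φ₂((v - s)/|a|^{1/2}) free of τ. The Jacobian is absorbed through
|aτ| 𝓕ψ₁(aτ) = 𝓕χ₁(aτ), so by one-dimensional Parseval the τ-integral is a wavelet coefficient of
ℛf(v, ·). Fubini gives the formula and the integrability in v together (`shearletTransform_projH`).

One-dimensional Parseval needs ℛf(v, ·) ∈ L². For a.e. v, Fubini makes |τ| |𝓕f(τ, vτ)|² integrable
in τ, and boundedness of 𝓕f handles small τ (`ae_memLp_radonH`).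

The vertical formula is the horizontal one conjugated by the exchange of coordinates, which commutes
with 𝓕. -/

open scoped SchwartzMap

namespace ConeShearlet

/-! ### The Fourier transform on L² tested against Schwartz functions -/

section General

variable {V : Type*} [NormedAddCommGroup V] [InnerProductSpace ℝ V] [FiniteDimensional ℝ V]
  [MeasurableSpace V] [BorelSpace V]

theorem integral_fourier_mul_Lp (g : 𝓢(V, ℂ)) (u : Lp ℂ 2 (volume : Measure V)) :
    ∫ x, (𝓕 g) x * u x = ∫ x, g x * (𝓕 u : Lp ℂ 2 (volume : Measure V)) x := by
  have h := congrArg (fun T => T g) (Lp.fourier_toTemperedDistribution_eq u)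
  simpa [TemperedDistribution.fourier_apply, Lp.toTemperedDistribution_apply] using h

/-- L² embeds injectively into tempered distributions, so a Plancherel transform can be identified
by its Schwartz pairings alone. -/
theorem fourier_toLp_eq_of_dual {u v : V → ℂ} (hu : MemLp u 2) (hv : MemLp v 2)
    (h : ∀ g : 𝓢(V, ℂ), ∫ x, (𝓕 g) x * u x = ∫ x, g x * v x) :
    𝓕 (hu.toLp u) = hv.toLp v := by
  have hinj := LinearMap.ker_eq_bot.mp
    (Lp.ker_toTemperedDistributionCLM_eq_bot (F := ℂ) (μ := (volume : Measure V)) (p := 2))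
  apply hinj
  ext g
  change (Lp.toTemperedDistribution (𝓕 (hu.toLp u))) g = (Lp.toTemperedDistribution (hv.toLp v)) g
  rw [Lp.toTemperedDistribution_apply, Lp.toTemperedDistribution_apply]
  simp only [smul_eq_mul]
  rw [← integral_fourier_mul_Lp]
  have e1 : ∫ x, (𝓕 g) x * (hu.toLp u) x = ∫ x, (𝓕 g) x * u x :=
    integral_congr_ae (by filter_upwards [hu.coeFn_toLp] with x hx; rw [hx])
  have e2 : ∫ x, g x * (hv.toLp v) x = ∫ x, g x * v x :=
    integral_congr_ae (by filter_upwards [hv.coeFn_toLp] with x hx; rw [hx])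
  rw [e1, e2, h g]

theorem integral_fourier_mul_integrable (g : 𝓢(V, ℂ)) {f : V → ℂ} (hf : Integrable f) :
    ∫ x, (𝓕 g) x * f x = ∫ x, g x * 𝓕 f x := by
  simpa using! VectorFourier.integral_fourierIntegral_smul_eq_flip (L := innerₗ V)
    Real.continuous_fourierChar continuous_inner g.integrable hf

theorem continuous_fourier_of_integrable {f : V → ℂ} (hf : Integrable f) : Continuous (𝓕 f) :=
  VectorFourier.fourierIntegral_continuous Real.continuous_fourierChar
    (L := innerₗ V) continuous_inner hf

/-- Locally integrable functions with the same Schwartz pairings agree almost everywhere. -/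
theorem ae_eq_of_integral_schwartz_mul_eq {u v : V → ℂ} (hu : LocallyIntegrable u)
    (hv : LocallyIntegrable v) (h : ∀ g : 𝓢(V, ℂ), ∫ x, g x * u x = ∫ x, g x * v x) :
    u =ᵐ[volume] v := by
  apply ae_eq_of_integral_contDiff_smul_eq hu hv
  intro g g_smooth g_cpt
  have hg₁ : HasCompactSupport (Complex.ofRealCLM ∘ g) := g_cpt.comp_left rfl
  have hg₂ : ContDiff ℝ (⊤ : ℕ∞) (Complex.ofRealCLM ∘ g) := by fun_prop
  simpa using h (hg₁.toSchwartzMap hg₂)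

/-- The Plancherel transform agrees with the Fourier integral on `L¹ ∩ L²`. -/
theorem fourier_toLp_ae_eq {f : V → ℂ} (hf : Integrable f) (hf2 : MemLp f 2) :
    (𝓕 (hf2.toLp f) : Lp ℂ 2 (volume : Measure V)) =ᵐ[volume] 𝓕 f := by
  apply ae_eq_of_integral_schwartz_mul_eq ((Lp.memLp _).locallyIntegrable (by norm_num))
    (continuous_fourier_of_integrable hf).locallyIntegrable
  intro g
  rw [← integral_fourier_mul_Lp, ← integral_fourier_mul_integrable g hf]
  exact integral_congr_ae (by filter_upwards [hf2.coeFn_toLp] with x hx; rw [hx])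

/-- An integrable function with square integrable Fourier transform is square integrable. -/
theorem memLp_two_of_fourier {f : V → ℂ} (hf : Integrable f) (h : MemLp (𝓕 f) 2) :
    MemLp f 2 := by
  set G : Lp ℂ 2 (volume : Measure V) := 𝓕⁻ (h.toLp (𝓕 f)) with hG
  have hFG : 𝓕 G = h.toLp (𝓕 f) := by rw [hG, FourierTransform.fourier_fourierInv_eq]
  have : (G : V → ℂ) =ᵐ[volume] f := by
    apply ae_eq_of_integral_schwartz_mul_eq ((Lp.memLp _).locallyIntegrable (by norm_num))
      hf.locallyIntegrable
    intro g
    -- Every test function is itself a transform, so both duality formulas apply and move 𝓕 onto `G`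
    -- and `f`.
    have e : g = 𝓕 (𝓕⁻ g) := (FourierTransform.fourier_fourierInv_eq g).symm
    rw [e, integral_fourier_mul_Lp, integral_fourier_mul_integrable _ hf, hFG]
    exact integral_congr_ae (by filter_upwards [h.coeFn_toLp] with x hx; rw [hx])
  exact (memLp_congr_ae this).mp (Lp.memLp G)

/-- Parseval's identity. -/
theorem integral_mul_conj_fourier (u v : Lp ℂ 2 (volume : Measure V)) :
    ∫ x, (𝓕 u : Lp ℂ 2 (volume : Measure V)) x * conj ((𝓕 v : Lp ℂ 2 (volume : Measure V)) x)
      = ∫ x, u x * conj (v x) := by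
  have h := Lp.inner_fourier_eq v u
  simpa [L2.inner_def] using h

theorem integrable_mul_conj {X : Type*} [MeasurableSpace X] {μ : Measure X} {u v : X → ℂ}
    (hu : MemLp u 2 μ) (hv : MemLp v 2 μ) : Integrable (fun x => u x * conj (v x)) μ := by
  have hv' : MemLp (fun x => conj (v x)) 2 μ := hv.star
  exact hu.integrable_mul hv'

/-! ### Affine changes of variables under the Plancherel transform -/

section Affine

theorem map_continuousLinearEquiv_volume (M : V ≃L[ℝ] V) :
    Measure.map M (volume : Measure V)
      = ENNReal.ofReal |(LinearMap.det (M : V →ₗ[ℝ] V))⁻¹| • volume :=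
  Measure.map_linearMap_addHaar_eq_smul_addHaar volume (LinearEquiv.isUnit_det' M.toLinearEquiv).ne_zero

theorem quasiMeasurePreserving_continuousLinearEquiv (M : V ≃L[ℝ] V) :
    Measure.QuasiMeasurePreserving M (volume : Measure V) volume := by
  refine ⟨M.continuous.measurable, ?_⟩
  rw [map_continuousLinearEquiv_volume]
  exact Measure.smul_absolutelyContinuous

theorem MemLp.comp_continuousLinearEquiv {u : V → ℂ} {p : ℝ≥0∞} (hu : MemLp u p)
    (M : V ≃L[ℝ] V) : MemLp (fun x => u (M x)) p := by
  have : MemLp u p (Measure.map M (volume : Measure V)) := by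
    rw [map_continuousLinearEquiv_volume]
    exact hu.smul_measure ENNReal.ofReal_ne_top
  exact this.comp_of_map M.continuous.measurable.aemeasurable

theorem MemLp.comp_affine {u : V → ℂ} {p : ℝ≥0∞} (hu : MemLp u p)
    (M : V ≃L[ℝ] V) (b : V) : MemLp (fun x => u (M (x - b))) p :=
  (MemLp.comp_continuousLinearEquiv hu M).comp_measurePreserving (measurePreserving_sub_right volume b)

theorem integral_comp_continuousLinearEquiv (M : V ≃L[ℝ] V) (h : V → ℂ) :
    ∫ x, h (M x) = ((|(LinearMap.det (M : V →ₗ[ℝ] V))⁻¹| : ℝ) : ℂ) * ∫ x, h x := by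
  have e := M.toHomeomorph.measurableEmbedding.integral_map (μ := (volume : Measure V)) h
  have : Measure.map (M.toHomeomorph) (volume : Measure V) = _ := map_continuousLinearEquiv_volume M
  rw [this, integral_smul_measure, ENNReal.toReal_ofReal (abs_nonneg _)] at e
  rw [← Complex.real_smul, e]
  rfl

variable (M M' : V ≃L[ℝ] V) (b : V)

/-- The hypothesis says that `M'` is the inverse adjoint of `M`. Hence y = M(x - b) turns the phase
⟨y, M'ζ⟩ into ⟨x, ζ⟩ - ⟨b, ζ⟩, and Fourier inversion for `g` finishes. -/
theorem fourierInv_fourier_comp_affine (hM : ∀ x y, inner ℝ (M x) (M' y) = inner ℝ x y)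
    (g : 𝓢(V, ℂ)) (ζ : V) :
    𝓕⁻ (fun y : V => ((𝓕 g : 𝓢(V, ℂ)) (M.symm y + b) : ℂ)) (M' ζ)
      = ((|(LinearMap.det (M : V →ₗ[ℝ] V))| : ℝ) : ℂ)
        * ((𝐞 (-inner ℝ b ζ) : ℂ) * g ζ) := by
  have hdet : (|(LinearMap.det (M : V →ₗ[ℝ] V))| : ℝ) ≠ 0 :=
    abs_ne_zero.mpr (LinearEquiv.isUnit_det' M.toLinearEquiv).ne_zero
  have hg : 𝓕⁻ (𝓕 (g : V → ℂ)) ζ = g ζ :=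
    congrFun (g.continuous.fourierInv_fourier_eq g.integrable (𝓕 g).integrable) ζ
  rw [Real.fourierInv_eq] at hg ⊢
  have e1 := integral_comp_continuousLinearEquiv M
    (fun y => 𝐞 (inner ℝ y (M' ζ)) • (𝓕 g) (M.symm y + b))
  have e2 := integral_sub_right_eq_self (μ := (volume : Measure V))
    (fun x => 𝐞 (inner ℝ (M x) (M' ζ)) • (𝓕 g) (M.symm (M x) + b)) b
  rw [← e2] at e1
  have e3 : ∀ x, 𝐞 (inner ℝ (M (x - b)) (M' ζ)) • (𝓕 g) (M.symm (M (x - b)) + b)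
      = (𝐞 (-inner ℝ b ζ) : ℂ) * (𝐞 (inner ℝ x ζ) • (𝓕 g) x) := by
    intro x
    rw [hM, inner_sub_left, ContinuousLinearEquiv.symm_apply_apply, sub_add_cancel,
      sub_eq_add_neg, AddChar.map_add_eq_mul, Circle.smul_def, Circle.smul_def, Circle.coe_mul,
      smul_eq_mul, smul_eq_mul]
    ring
  simp_rw [e3] at e1
  rw [integral_const_mul] at e1
  rw [SchwartzMap.fourier_coe] at e1 ⊢
  rw [hg] at e1
  rw [e1, abs_inv, ← mul_assoc, ← Complex.ofReal_mul, mul_inv_cancel₀ hdet]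
  simp

/-- The Plancherel transform of an affine change of variables. -/
theorem fourier_comp_affine (hM : ∀ x y, inner ℝ (M x) (M' y) = inner ℝ x y)
    (u : Lp ℂ 2 (volume : Measure V)) :
    (𝓕 ((MemLp.comp_affine (Lp.memLp u) M b).toLp _) : Lp ℂ 2 (volume : Measure V)) =ᵐ[volume]
      fun ξ => ((|LinearMap.det (M' : V →ₗ[ℝ] V)| : ℝ) : ℂ)
        * ((𝐞 (-inner ℝ b ξ) : ℂ) * (𝓕 u : Lp ℂ 2 (volume : Measure V)) (M' ξ)) := by
  have hdet : (|(LinearMap.det (M : V →ₗ[ℝ] V))| : ℝ) ≠ 0 :=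
    abs_ne_zero.mpr (LinearEquiv.isUnit_det' M.toLinearEquiv).ne_zero
  have hdet' : (|(LinearMap.det (M' : V →ₗ[ℝ] V))| : ℝ) ≠ 0 :=
    abs_ne_zero.mpr (LinearEquiv.isUnit_det' M'.toLinearEquiv).ne_zero
  set U : Lp ℂ 2 (volume : Measure V) := 𝓕 u with hU
  have hv : MemLp (fun ξ => ((|LinearMap.det (M' : V →ₗ[ℝ] V)| : ℝ) : ℂ)
        * ((𝐞 (-inner ℝ b ξ) : ℂ) * U (M' ξ))) 2 := by
    refine MemLp.const_mul ?_ _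
    have h1 : MemLp (fun ξ => U (M' ξ)) 2 := MemLp.comp_continuousLinearEquiv (Lp.memLp U) M'
    refine h1.of_le ?_ (Filter.Eventually.of_forall fun ξ => ?_)
    · refine AEStronglyMeasurable.mul (Continuous.aestronglyMeasurable ?_) h1.1
      exact continuous_subtype_val.comp
        (Real.continuous_fourierChar.comp (by fun_prop))
    · rw [norm_mul, Circle.norm_coe, one_mul]
  rw [fourier_toLp_eq_of_dual (MemLp.comp_affine (Lp.memLp u) M b) hv]
  · exact hv.coeFn_toLp
  intro g
  -- The affine map is moved from `u` to the test function: `k` is `𝓕 g` composed with the inverse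
  -- of x ↦ M(x - b).
  let k : 𝓢(V, ℂ) := SchwartzMap.compCLMOfContinuousLinearEquiv ℂ M.symm
    (SchwartzMap.compSubConstCLM ℂ (-b) (𝓕 g))
  have hk : ∀ y, k y = (𝓕 g) (M.symm y + b) := fun y => by simp [k]
  have hk' : ∀ ζ, (𝓕⁻ k) (M' ζ) = ((|(LinearMap.det (M : V →ₗ[ℝ] V))| : ℝ) : ℂ)
        * ((𝐞 (-inner ℝ b ζ) : ℂ) * g ζ) := fun ζ => by
    rw [← fourierInv_fourier_comp_affine M M' b hM g ζ, SchwartzMap.fourierInv_coe]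
    rw [show (k : V → ℂ) = _ from funext hk]
  have e1 : ∫ x, (𝓕 g) x * u (M (x - b))
      = ((|(LinearMap.det (M : V →ₗ[ℝ] V))⁻¹| : ℝ) : ℂ) * ∫ y, k y * u y := by
    rw [← integral_comp_continuousLinearEquiv M,
      ← integral_sub_right_eq_self (μ := (volume : Measure V)) (fun x => k (M x) * u (M x)) b]
    simp only [hk, ContinuousLinearEquiv.symm_apply_apply, sub_add_cancel]
  have e2 : ∫ y, k y * u y = ∫ y, (𝓕⁻ k) y * U y := by
    rw [hU, ← integral_fourier_mul_Lp, FourierTransform.fourier_fourierInv_eq]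
  have e3 := integral_comp_continuousLinearEquiv M' (fun y => (𝓕⁻ k) y * U y)
  rw [abs_inv, Complex.ofReal_inv, eq_inv_mul_iff_mul_eq₀ (by exact_mod_cast hdet')] at e3
  rw [e1, e2, ← e3, ← mul_assoc, ← integral_const_mul]
  congr 1
  ext ξ
  have : ((|(LinearMap.det (M : V →ₗ[ℝ] V))| : ℝ) : ℂ) ≠ 0 := by exact_mod_cast hdet
  rw [hk', abs_inv, Complex.ofReal_inv]
  field_simp

end Affine

end General

/-! ### Slope coordinates on the plane and the shear along Radon lines -/

section Coordinates

theorem measurePreserving_pair :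
    MeasurePreserving (fun p : ℝ × ℝ => (!₂[p.1, p.2] : Plane)) volume volume := by
  have h := ((EuclideanSpace.volume_preserving_symm_measurableEquiv_toLp (Fin 2)).symm).comp
    ((volume_preserving_finTwoArrow ℝ).symm)
  exact h

theorem continuous_slope : Continuous fun p : ℝ × ℝ => (!₂[p.2, p.1 * p.2] : Plane) := by
  fun_prop

theorem measurable_nnabs_snd : Measurable fun p : ℝ × ℝ => Real.nnabs p.2 :=
  Measurable.subtype_mk (continuous_abs.comp continuous_snd).measurable

/-- Lebesgue measure of the plane in the coordinates slope and abscissa. -/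
theorem map_slope_volume :
    Measure.map (fun p : ℝ × ℝ => (!₂[p.2, p.1 * p.2] : Plane))
      ((volume : Measure (ℝ × ℝ)).withDensity fun p => (Real.nnabs p.2 : ℝ≥0∞)) = volume := by
  have hm := continuous_slope.measurable
  ext s hs
  have hd : Measurable fun p : ℝ × ℝ => (Real.nnabs p.2 : ℝ≥0∞) :=
    measurable_nnabs_snd.coe_nnreal_ennreal
  have hind : Measurable (s.indicator (1 : Plane → ℝ≥0∞)) := measurable_one.indicator hs
  rw [Measure.map_apply hm hs, ← lintegral_indicator_one (hm hs),
    lintegral_withDensity_eq_lintegral_mul _ hd (measurable_one.indicator (hm hs)),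
    ← lintegral_indicator_one hs, ← measurePreserving_pair.lintegral_comp hind,
    Measure.volume_eq_prod, lintegral_prod_symm _ (by
      exact (hd.mul (measurable_one.indicator (hm hs))).aemeasurable),
    lintegral_prod (fun p : ℝ × ℝ => s.indicator (1 : Plane → ℝ≥0∞) !₂[p.1, p.2])
      (hind.comp measurePreserving_pair.measurable).aemeasurable]
  apply lintegral_congr_ae
  filter_upwards [Measure.ae_ne volume (0 : ℝ)] with τ hτ
  have hy : Measurable fun y : ℝ => s.indicator (1 : Plane → ℝ≥0∞) !₂[τ, y] :=
    hind.comp (by fun_prop)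
  -- At fixed abscissa τ ≠ 0, the substitution y = vτ produces the Jacobian |τ|.
  conv_rhs => rw [← Real.smul_map_volume_mul_right hτ]
  rw [lintegral_smul_measure, lintegral_map hy (by fun_prop), smul_eq_mul,
    ← lintegral_const_mul (f := fun x : ℝ => s.indicator (1 : Plane → ℝ≥0∞) !₂[τ, x * τ]) _
      (hind.comp (by fun_prop))]
  apply lintegral_congr
  intro v
  simp only [Pi.mul_apply]
  congr 1
  rw [← Real.coe_nnabs, ENNReal.ofReal_coe_nnreal]

theorem integrable_slope {H : Plane → ℂ} (hH : Integrable H) :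
    Integrable fun p : ℝ × ℝ => ((|p.2| : ℝ) : ℂ) * H !₂[p.2, p.1 * p.2] := by
  have h1 := hH
  rw [← map_slope_volume] at h1
  have h2 := h1.comp_measurable continuous_slope.measurable
  rw [integrable_withDensity_iff_integrable_smul measurable_nnabs_snd] at h2
  refine h2.congr (Filter.Eventually.of_forall fun p => ?_)
  simp [NNReal.smul_def]

theorem integral_slope {H : Plane → ℂ} (hH : Integrable H) :
    ∫ ξ, H ξ = ∫ p : ℝ × ℝ, ((|p.2| : ℝ) : ℂ) * H !₂[p.2, p.1 * p.2] := by
  have h1 := hH.1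
  rw [← map_slope_volume] at h1
  conv_lhs => rw [← map_slope_volume]
  rw [integral_map continuous_slope.measurable.aemeasurable h1,
    integral_withDensity_eq_integral_smul measurable_nnabs_snd]
  refine integral_congr_ae (Filter.Eventually.of_forall fun p => ?_)
  simp [NNReal.smul_def]

/-- The density |τ| vanishes only on a null set, so Lebesgue measure is absolutely continuous with
respect to the weighted one. This lets a.e. statements about ξ be read at (τ, vτ). -/
theorem quasiMeasurePreserving_slope :
    Measure.QuasiMeasurePreserving (fun p : ℝ × ℝ => (!₂[p.2, p.1 * p.2] : Plane))
      volume volume := by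
  have h : (volume : Measure (ℝ × ℝ)) ≪
      (volume : Measure (ℝ × ℝ)).withDensity fun p => (Real.nnabs p.2 : ℝ≥0∞) := by
    apply withDensity_absolutelyContinuous'
    · exact measurable_nnabs_snd.coe_nnreal_ennreal.aemeasurable
    · have : ∀ᵐ p : ℝ × ℝ, p.2 ≠ 0 :=
        Measure.quasiMeasurePreserving_snd.ae (Measure.ae_ne volume (0 : ℝ))
      filter_upwards [this] with p hp
      simpa using hp
  exact ⟨continuous_slope.measurable, (h.map continuous_slope.measurable).trans
    (by rw [map_slope_volume])⟩

/-- A shear is a family of translations fibred over y. The swaps are there because `skew_product`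
acts on the second coordinate. -/
theorem measurePreserving_radonLine (v : ℝ) :
    MeasurePreserving (fun p : ℝ × ℝ => (!₂[p.1 - v * p.2, p.2] : Plane)) volume volume := by
  have h : MeasurePreserving (fun p : ℝ × ℝ => (p.1, p.2 - v * p.1))
      ((volume : Measure ℝ).prod (volume : Measure ℝ)) ((volume : Measure ℝ).prod volume) := by
    refine (MeasurePreserving.id (volume : Measure ℝ)).skew_product
      (g := fun y t => t - v * y) (by fun_prop) (Filter.Eventually.of_forall fun y => ?_)
    exact (measurePreserving_sub_right volume (v * y)).map_eq
  exact measurePreserving_pair.comp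
    ((Measure.measurePreserving_swap (μ := (volume : Measure ℝ)) (ν := (volume : Measure ℝ))).comp
      (h.comp (Measure.measurePreserving_swap (μ := (volume : Measure ℝ))
        (ν := (volume : Measure ℝ)))))

end Coordinates

/-! ### The Fourier slice theorem and square integrability of the Radon transform -/

section Slice

variable {f : Plane → ℂ}

theorem integrable_radonLine (hf : Integrable f) (v : ℝ) :
    Integrable (fun p : ℝ × ℝ => f !₂[p.1 - v * p.2, p.2]) :=
  (measurePreserving_radonLine v).integrable_comp_of_integrable hf

theorem integrable_radonH (hf : Integrable f) (v : ℝ) : Integrable (radonH f v) :=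
  (integrable_radonLine hf v).integral_prod_left

theorem inner_pair (a b c d : ℝ) : inner ℝ (!₂[a, b] : Plane) !₂[c, d] = a * c + b * d := by
  simp [PiLp.inner_apply, Fin.sum_univ_two, mul_comm]

/-- The Fourier slice theorem. -/
theorem fourier_radonH (hf : Integrable f) (v τ : ℝ) :
    𝓕 (radonH f v) τ = 𝓕 f !₂[τ, v * τ] := by
  have hg : Integrable fun z : Plane => 𝐞 (-inner ℝ z !₂[τ, v * τ]) • f z :=
    (Real.fourierIntegral_convergent_iff _).mpr hf
  have hmp := measurePreserving_radonLine v
  rw [Real.fourier_eq, Real.fourier_eq]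
  have e : ∫ z : Plane, 𝐞 (-inner ℝ z !₂[τ, v * τ]) • f z
      = ∫ p : ℝ × ℝ, 𝐞 (-inner ℝ (!₂[p.1 - v * p.2, p.2] : Plane) !₂[τ, v * τ])
          • f !₂[p.1 - v * p.2, p.2] := by
    conv_lhs => rw [← hmp.map_eq]
    rw [integral_map hmp.measurable.aemeasurable (by rw [hmp.map_eq]; exact hg.1)]
  rw [e, Measure.volume_eq_prod, integral_prod (fun p : ℝ × ℝ =>
    𝐞 (-inner ℝ (!₂[p.1 - v * p.2, p.2] : Plane) !₂[τ, v * τ]) • f !₂[p.1 - v * p.2, p.2])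
      (hmp.integrable_comp_of_integrable hg)]
  congr 1
  ext t
  simp only [radonH, inner_pair]
  simp only [Circle.smul_def]
  rw [← integral_smul]
  congr 1
  ext y
  congr 3
  simp
  ring

/-- The weight |τ| helps for |τ| > 1 and is lost near the origin, where the uniform bound on a
bounded interval replaces it. -/
theorem integrable_sq_of_abs_mul {h : ℝ → ℂ} (hc : Continuous h) {C : ℝ} (hC : ∀ τ, ‖h τ‖ ≤ C)
    (hi : Integrable fun τ => |τ| * ‖h τ‖ ^ 2) : Integrable fun τ => ‖h τ‖ ^ 2 := by
  have hb : Integrable ((Set.Icc (-1 : ℝ) 1).indicator fun _ => C ^ 2) :=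
    (integrable_indicator_iff measurableSet_Icc).mpr (integrableOn_const (by simp))
  refine (hi.add hb).mono' (by fun_prop) (Filter.Eventually.of_forall fun τ => ?_)
  rw [Real.norm_of_nonneg (by positivity), Pi.add_apply]
  by_cases hτ : |τ| ≤ 1
  · rw [Set.indicator_of_mem (show τ ∈ Set.Icc (-1 : ℝ) 1 from abs_le.mp hτ)]
    have : ‖h τ‖ ^ 2 ≤ C ^ 2 := pow_le_pow_left₀ (norm_nonneg _) (hC τ) 2
    have : 0 ≤ |τ| * ‖h τ‖ ^ 2 := by positivity
    linarith
  · rw [Set.indicator_of_notMem (s := Set.Icc (-1 : ℝ) 1) (fun h => hτ (abs_le.mpr h)), add_zero]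
    exact le_mul_of_one_le_left (by positivity) (not_le.mp hτ).le

theorem norm_fourier_le {V : Type*} [NormedAddCommGroup V] [InnerProductSpace ℝ V]
    [FiniteDimensional ℝ V] [MeasurableSpace V] [BorelSpace V] (f : V → ℂ) (ξ : V) :
    ‖𝓕 f ξ‖ ≤ ∫ x, ‖f x‖ :=
  VectorFourier.norm_fourierIntegral_le_integral_norm _ _ _ _ _

/-- Plancherel in slope coordinates makes |τ| |𝓕f(τ, vτ)|² integrable in (v, τ), hence in τ for a.e.
v. The slice theorem reads this as a bound on the transform of ℛf(v, ·), whose low frequencies are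
bounded by its L¹ norm. -/
theorem ae_memLp_radonH (hf : Integrable f) (hf2 : MemLp f 2) :
    ∀ᵐ v : ℝ, MemLp (radonH f v) 2 := by
  have hF : MemLp (𝓕 f) 2 := (memLp_congr_ae (fourier_toLp_ae_eq hf hf2)).mp (Lp.memLp _)
  have h1 : Integrable fun ξ => 𝓕 f ξ * conj (𝓕 f ξ) := integrable_mul_conj hF hF
  have h2 := (integrable_slope h1).norm
  filter_upwards [h2.prod_right_ae] with v hv
  apply memLp_two_of_fourier (integrable_radonH hf v)
  have hc := continuous_fourier_of_integrable (integrable_radonH hf v)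
  rw [memLp_two_iff_integrable_sq_norm hc.aestronglyMeasurable]
  apply integrable_sq_of_abs_mul hc (C := ∫ t, ‖radonH f v t‖) (norm_fourier_le _)
  refine hv.congr (Filter.Eventually.of_forall fun τ => ?_)
  simp [fourier_radonH hf, pow_two]

end Slice

/-! ### Wavelet coefficients in the frequency domain -/

section Wavelet

/-- Multiplication by a nonzero real number. -/
noncomputable def dilLine (a : ℝ) (ha : a ≠ 0) : ℝ ≃L[ℝ] ℝ :=
  ContinuousLinearEquiv.unitsEquivAut ℝ (Units.mk0 a ha)

@[simp] theorem dilLine_apply (a : ℝ) (ha : a ≠ 0) (x : ℝ) : dilLine a ha x = x * a := rfl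

theorem det_dilLine (a : ℝ) (ha : a ≠ 0) :
    LinearMap.det (dilLine a ha : ℝ →ₗ[ℝ] ℝ) = a := by
  have : (dilLine a ha : ℝ →ₗ[ℝ] ℝ) = a • LinearMap.id := by ext; simp
  rw [this, LinearMap.det_smul]
  simp

/-- The wavelet transform in the frequency domain. -/
theorem waveletTransform_eq_integral_fourier (χ : L2Line) {h : ℝ → ℂ} (hi : Integrable h)
    (h2 : MemLp h 2) (b : ℝ) {a : ℝ} (ha : a ≠ 0) :
    waveletTransform χ h b a = ((|a| ^ (-(1 / 2) : ℝ) * |a| : ℝ) : ℂ) *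
      ∫ τ, 𝓕 h τ * conj ((𝐞 (-(b * τ)) : ℂ) * (𝓕 χ : L2Line) (τ * a)) := by
  set M := dilLine a⁻¹ (inv_ne_zero ha)
  set M' := dilLine a ha
  have hM : ∀ x y, inner ℝ (M x) (M' y) = inner ℝ x y := by
    intro x y
    simp only [M, M', dilLine_apply, RCLike.inner_apply, conj_trivial]
    field_simp
  have hF := fourier_comp_affine M M' b hM χ
  have hmem := MemLp.comp_affine (Lp.memLp χ) M b
  have hP := integral_mul_conj_fourier (h2.toLp h) (hmem.toLp _)
  have e1 : ∫ t, (h2.toLp h) t * conj ((hmem.toLp _) t) = ∫ t, h t * conj (χ ((t - b) / a)) :=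
    integral_congr_ae (by
      filter_upwards [h2.coeFn_toLp, hmem.coeFn_toLp] with t h1 h2
      rw [h1, h2]
      simp [M, div_eq_mul_inv])
  have e2 : waveletTransform χ h b a
      = ((|a| ^ (-(1 / 2) : ℝ) : ℝ) : ℂ) * ∫ t, h t * conj (χ ((t - b) / a)) := by
    rw [waveletTransform, scalar, ← integral_const_mul]
    congr 1
    ext t
    simp only [waveletAct, map_mul, Complex.conj_ofReal]
    ring
  rw [e2, ← e1, ← hP, Complex.ofReal_mul, mul_assoc]
  congr 1
  rw [← integral_const_mul]
  apply integral_congr_ae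
  filter_upwards [hF, fourier_toLp_ae_eq hi h2] with τ h1 h2
  rw [h1, h2, det_dilLine]
  simp only [map_mul, Complex.conj_ofReal, M', dilLine_apply, RCLike.inner_apply, conj_trivial,
    mul_comm b τ]
  ring

end Wavelet

/-! ### The shearlet action in the frequency domain -/

section Shearlet

theorem dilA_inv_mul_shearN_inv (s : ℝ) {a : ℝ} (ha : a ≠ 0) :
    (dilA a)⁻¹ * (shearN s)⁻¹
      = !![a⁻¹, s * a⁻¹; 0, (a * |a| ^ (-(1 / 2) : ℝ))⁻¹] := by
  have hr : |a| ^ (-(1 / 2) : ℝ) ≠ 0 := (Real.rpow_pos_of_pos (abs_pos.mpr ha) _).ne'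
  rw [← Matrix.mul_inv_rev]
  apply Matrix.inv_eq_right_inv
  ext i j
  fin_cases i <;> fin_cases j <;>
    simp [shearN, dilA, Matrix.mul_apply, Fin.sum_univ_two, ha] <;> field_simp; ring

theorem dilAv_inv_mul_shearNv_inv (s : ℝ) {a : ℝ} (ha : a ≠ 0) :
    (dilAv a)⁻¹ * (shearNv s)⁻¹
      = !![(a * |a| ^ (-(1 / 2) : ℝ))⁻¹, 0; s * a⁻¹, a⁻¹] := by
  have hr : |a| ^ (-(1 / 2) : ℝ) ≠ 0 := (Real.rpow_pos_of_pos (abs_pos.mpr ha) _).ne'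
  rw [← Matrix.mul_inv_rev]
  apply Matrix.inv_eq_right_inv
  ext i j
  fin_cases i <;> fin_cases j <;>
    simp [shearNv, dilAv, Matrix.mul_apply, Fin.sum_univ_two, ha] <;> field_simp; ring

theorem det_toEuclideanLin (B : Matrix (Fin 2) (Fin 2) ℝ) :
    LinearMap.det (Matrix.toEuclideanLin B) = B.det := by
  rw [Matrix.toEuclideanLin, Matrix.toLpLin_eq_toLin, LinearMap.det_toLin]

/-- The linear automorphism of the plane given by an invertible matrix. -/
noncomputable def matrixEquiv (B : Matrix (Fin 2) (Fin 2) ℝ) (hB : B.det ≠ 0) : Plane ≃L[ℝ] Plane :=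
  (LinearMap.equivOfDetNeZero (Matrix.toEuclideanLin B)
    (by rwa [det_toEuclideanLin])).toContinuousLinearEquiv

@[simp] theorem matrixEquiv_apply (B : Matrix (Fin 2) (Fin 2) ℝ) (hB : B.det ≠ 0) (x : Plane) :
    matrixEquiv B hB x = Matrix.toEuclideanLin B x := rfl

theorem det_matrixEquiv (B : Matrix (Fin 2) (Fin 2) ℝ) (hB : B.det ≠ 0) :
    LinearMap.det (matrixEquiv B hB : Plane →ₗ[ℝ] Plane) = B.det :=
  det_toEuclideanLin B

theorem toEuclideanLin_pair (p q r t : ℝ) (z : Plane) :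
    Matrix.toEuclideanLin !![p, q; r, t] z = !₂[p * z 0 + q * z 1, r * z 0 + t * z 1] := by
  ext i
  fin_cases i <;> simp [Matrix.toLpLin_apply, dotProduct, Fin.sum_univ_two]

variable (s : ℝ) {a : ℝ} (ha : a ≠ 0)

/-- The linear map `A_a⁻¹ N_s⁻¹`. -/
noncomputable def shearletEquiv : Plane ≃L[ℝ] Plane :=
  matrixEquiv !![a⁻¹, s * a⁻¹; 0, (a * |a| ^ (-(1 / 2) : ℝ))⁻¹] (by
    rw [Matrix.det_fin_two_of]; simp [ha])

/-- The linear map `(N_s A_a)ᵀ` acting on frequencies. -/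
noncomputable def shearletDualEquiv : Plane ≃L[ℝ] Plane :=
  matrixEquiv !![a, 0; -(s * (a * |a| ^ (-(1 / 2) : ℝ))), a * |a| ^ (-(1 / 2) : ℝ)] (by
    rw [Matrix.det_fin_two_of]; simp [ha])

theorem shearletEquiv_apply (z : Plane) : shearletEquiv s ha z =
    !₂[a⁻¹ * z 0 + s * a⁻¹ * z 1, 0 * z 0 + (a * |a| ^ (-(1 / 2) : ℝ))⁻¹ * z 1] := by
  rw [shearletEquiv, matrixEquiv_apply, toEuclideanLin_pair]

theorem shearletDualEquiv_apply (z : Plane) : shearletDualEquiv s ha z =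
    !₂[a * z 0 + 0 * z 1,
      -(s * (a * |a| ^ (-(1 / 2) : ℝ))) * z 0 + a * |a| ^ (-(1 / 2) : ℝ) * z 1] := by
  rw [shearletDualEquiv, matrixEquiv_apply, toEuclideanLin_pair]

theorem inner_shearletEquiv (x y : Plane) :
    inner ℝ (shearletEquiv s ha x) (shearletDualEquiv s ha y) = inner ℝ x y := by
  have hr : |a| ^ (-(1 / 2) : ℝ) ≠ 0 := (Real.rpow_pos_of_pos (abs_pos.mpr ha) _).ne'
  rw [shearletEquiv_apply, shearletDualEquiv_apply, inner_pair, PiLp.inner_apply,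
    Fin.sum_univ_two]
  simp only [RCLike.inner_apply, conj_trivial]
  field_simp
  ring

theorem abs_det_shearletDualEquiv :
    |LinearMap.det (shearletDualEquiv s ha : Plane →ₗ[ℝ] Plane)| = |a| ^ (3 / 2 : ℝ) := by
  have hp := abs_pos.mpr ha
  rw [shearletDualEquiv, det_matrixEquiv, Matrix.det_fin_two_of]
  simp only [zero_mul, sub_zero, abs_mul, abs_of_pos (Real.rpow_pos_of_pos hp _)]
  conv_lhs => rw [← Real.rpow_one |a|]
  rw [← Real.rpow_mul hp.le, ← Real.rpow_add hp, ← Real.rpow_add hp]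
  norm_num

theorem shearletAct_eq (b : Plane) (ψ : Plane → ℂ) (z : Plane) :
    shearletAct b s a ψ z
      = ((|a| ^ (-(3 / 4) : ℝ) : ℝ) : ℂ) * ψ (shearletEquiv s ha (z - b)) := by
  rw [shearletAct, dilA_inv_mul_shearN_inv s ha]
  rfl

/-- The shearlet generator moved by `A_a⁻¹ N_s⁻¹ (· - b)`, without normalization. -/
noncomputable def movedShearlet (ψ : L2Plane) (b : Plane) : L2Plane :=
  (MemLp.comp_affine (Lp.memLp ψ) (shearletEquiv s ha) b).toLp _

theorem shearletTransform_eq (ψ F : L2Plane) (b : Plane) :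
    shearletTransform ψ F b s a = ((|a| ^ (-(3 / 4) : ℝ) : ℝ) : ℂ) *
      ∫ ξ, (𝓕 F : L2Plane) ξ * conj ((𝓕 (movedShearlet s ha ψ b) : L2Plane) ξ) := by
  rw [integral_mul_conj_fourier, shearletTransform, scalar, ← integral_const_mul]
  apply integral_congr_ae
  filter_upwards [(MemLp.comp_affine (Lp.memLp ψ) (shearletEquiv s ha) b).coeFn_toLp] with z hz
  rw [movedShearlet, hz, shearletAct_eq s ha]
  simp only [map_mul, Complex.conj_ofReal]
  ring

/-- The dual map sends (τ, vτ) to a point with abscissa aτ and slope (v - s)|a|^{-1/2}. Scale thus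
acts on τ alone, and the slope does not involve τ, so the product form of 𝓕ψ separates the
variables. -/
theorem fourier_movedShearlet (ψ₁ ψ₂ : L2Line) (ψ : L2Plane)
    (hψ : ∀ᵐ ξ : Plane, (𝓕 ψ : L2Plane) ξ
      = (𝓕 ψ₁ : L2Line) (ξ 0) * (𝓕 ψ₂ : L2Line) (ξ 1 / ξ 0)) (b : Plane) :
    ∀ᵐ p : ℝ × ℝ, (𝓕 (movedShearlet s ha ψ b) : L2Plane) !₂[p.2, p.1 * p.2]
      = ((|a| ^ (3 / 2 : ℝ) : ℝ) : ℂ) * ((𝐞 (-((b 0 + p.1 * b 1) * p.2)) : ℂ) *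
        ((𝓕 ψ₁ : L2Line) (p.2 * a) * (𝓕 ψ₂ : L2Line) ((p.1 - s) / |a| ^ (1 / 2 : ℝ)))) := by
  have hp := abs_pos.mpr ha
  have h1 := quasiMeasurePreserving_slope.ae (fourier_comp_affine _ _ b (inner_shearletEquiv s ha) ψ)
  have h2 := quasiMeasurePreserving_slope.ae
    ((quasiMeasurePreserving_continuousLinearEquiv (shearletDualEquiv s ha)).ae hψ)
  have h3 : ∀ᵐ p : ℝ × ℝ, p.2 ≠ 0 :=
    Measure.quasiMeasurePreserving_snd.ae (Measure.ae_ne volume (0 : ℝ))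
  filter_upwards [h1, h2, h3] with p e1 e2 e3
  have hr : |a| ^ (1 / 2 : ℝ) ≠ 0 := (Real.rpow_pos_of_pos hp _).ne'
  rw [movedShearlet, e1, e2, abs_det_shearletDualEquiv, shearletDualEquiv_apply]
  have i1 : inner ℝ b (!₂[p.2, p.1 * p.2] : Plane) = (b 0 + p.1 * b 1) * p.2 := by
    simp only [PiLp.inner_apply, Fin.sum_univ_two, RCLike.inner_apply, conj_trivial]
    simp
    ring
  rw [i1]
  congr 3
  · congr 1
    simp
    ring
  · congr 1
    simp only [Real.rpow_neg hp.le, Matrix.cons_val_zero, Matrix.cons_val_one, zero_mul, add_zero]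
    generalize |a| ^ (1 / 2 : ℝ) = r at hr
    field_simp
    ring

end Shearlet

/-! ### The horizontal formula -/

section Horizontal

theorem fourier_projH (F : L2Plane) :
    (𝓕 (projH F) : L2Plane) =ᵐ[volume] coneH.indicator (𝓕 F : L2Plane) := by
  rw [projH, freqProj, FourierTransform.fourier_fourierInv_eq, cutoff]
  exact MemLp.coeFn_toLp _

theorem slope_mem_coneH {v τ : ℝ} (hτ : τ ≠ 0) :
    (!₂[τ, v * τ] : Plane) ∈ coneH ↔ v ∈ Set.Icc (-1 : ℝ) 1 := by
  simp [coneH, hτ, abs_le]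

variable {ψ₁ ψ₂ χ₁ : L2Line} {ψ : L2Plane} {f : Plane → ℂ}

theorem shearletTransform_projH
    (hψ : ∀ᵐ ξ : Plane, (𝓕 ψ : L2Plane) ξ
      = (𝓕 ψ₁ : L2Line) (ξ 0) * (𝓕 ψ₂ : L2Line) (ξ 1 / ξ 0))
    (hχ₁ : ∀ᵐ τ : ℝ, (𝓕 χ₁ : L2Line) τ = ((|τ| : ℝ) : ℂ) * (𝓕 ψ₁ : L2Line) τ)
    (hf : Integrable f) (hf2 : MemLp f 2) (b : Plane) (s : ℝ) {a : ℝ} (ha : a ≠ 0) :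
    IntervalIntegrable (fun v : ℝ =>
        waveletTransform χ₁ (radonH f v) (b 0 + v * b 1) a *
          conj ((𝓕 ψ₂ : L2Line) ((v - s) / |a| ^ (1 / 2 : ℝ)))) volume (-1) 1 ∧
      shearletTransform ψ (projH (hf2.toLp f)) b s a =
        ((|a| ^ (-(3 / 4) : ℝ) : ℝ) : ℂ) *
          ∫ v in (-1 : ℝ)..1,
            waveletTransform χ₁ (radonH f v) (b 0 + v * b 1) a *
              conj ((𝓕 ψ₂ : L2Line) ((v - s) / |a| ^ (1 / 2 : ℝ))) := by
  have hp := abs_pos.mpr ha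
  set K : ℝ → ℂ := fun v => waveletTransform χ₁ (radonH f v) (b 0 + v * b 1) a *
          conj ((𝓕 ψ₂ : L2Line) ((v - s) / |a| ^ (1 / 2 : ℝ))) with hK
  set G : L2Plane := 𝓕 (movedShearlet s ha ψ b) with hG
  set P : L2Plane := 𝓕 (projH (hf2.toLp f)) with hP
  have hint : Integrable fun ξ => P ξ * conj (G ξ) := integrable_mul_conj (Lp.memLp P) (Lp.memLp G)
  have hprod := integrable_slope hint
  rw [Measure.volume_eq_prod] at hprod
  have key : ∀ᵐ p : ℝ × ℝ, ((|p.2| : ℝ) : ℂ) *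
      (P !₂[p.2, p.1 * p.2] * conj (G !₂[p.2, p.1 * p.2]))
      = (Set.Icc (-1 : ℝ) 1).indicator (fun v =>
          conj ((𝓕 ψ₂ : L2Line) ((v - s) / |a| ^ (1 / 2 : ℝ)))) p.1 *
        (((|a| ^ (-(1 / 2) : ℝ) * |a| : ℝ) : ℂ) * (𝓕 (radonH f p.1) p.2 *
          conj ((𝐞 (-((b 0 + p.1 * b 1) * p.2)) : ℂ) * (𝓕 χ₁ : L2Line) (p.2 * a)))) := by
    have h1 := quasiMeasurePreserving_slope.ae (fourier_projH (hf2.toLp f))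
    have h2 := quasiMeasurePreserving_slope.ae (fourier_toLp_ae_eq hf hf2)
    have h3 : ∀ᵐ p : ℝ × ℝ, p.2 ≠ 0 :=
      Measure.quasiMeasurePreserving_snd.ae (Measure.ae_ne volume (0 : ℝ))
    have h4 : ∀ᵐ p : ℝ × ℝ, (𝓕 χ₁ : L2Line) (p.2 * a)
        = ((|p.2 * a| : ℝ) : ℂ) * (𝓕 ψ₁ : L2Line) (p.2 * a) :=
      Measure.quasiMeasurePreserving_snd.ae
        ((quasiMeasurePreserving_continuousLinearEquiv (dilLine a ha)).ae hχ₁)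
    filter_upwards [h1, h2, h3, h4, fourier_movedShearlet s ha ψ₁ ψ₂ ψ hψ b]
      with p e1 e2 e3 e4 e5
    rw [hP, hG, e1, e5, e4, fourier_radonH hf]
    by_cases hv : p.1 ∈ Set.Icc (-1 : ℝ) 1
    · rw [Set.indicator_of_mem ((slope_mem_coneH e3).mpr hv), Set.indicator_of_mem hv, e2]
      -- One factor |a| joins the Jacobian |τ| to form the |τa| of 𝓕χ₁; the remaining |a|^{-1/2}|a|
      -- is the constant in the wavelet formula.
      have hc : (|a| ^ (3 / 2 : ℝ) : ℝ) = |a| ^ (-(1 / 2) : ℝ) * |a| * |a| := by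
        conv_rhs => rw [mul_assoc, ← pow_two, ← Real.rpow_natCast, ← Real.rpow_add hp]
        norm_num
      rw [hc, abs_mul]
      simp only [map_mul, Complex.conj_ofReal, Complex.ofReal_mul]
      ring
    · rw [Set.indicator_of_notMem (fun h => hv ((slope_mem_coneH e3).mp h)),
        Set.indicator_of_notMem hv]
      simp
  have hslice : (fun v => ∫ τ, ((|τ| : ℝ) : ℂ) *
      (P !₂[τ, v * τ] * conj (G !₂[τ, v * τ]))) =ᵐ[volume] (Set.Icc (-1 : ℝ) 1).indicator K := by
    filter_upwards [Measure.ae_ae_of_ae_prod key, ae_memLp_radonH hf hf2] with v hv hv2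
    rw [integral_congr_ae hv, integral_const_mul, integral_const_mul,
      ← waveletTransform_eq_integral_fourier χ₁ (integrable_radonH hf v) hv2 _ ha]
    by_cases hmem : v ∈ Set.Icc (-1 : ℝ) 1
    · rw [Set.indicator_of_mem hmem, Set.indicator_of_mem hmem, hK, mul_comm]
    · rw [Set.indicator_of_notMem hmem, Set.indicator_of_notMem hmem, zero_mul]
  -- On [-1, 1], `K` is a.e. a fibre integral of an integrable function, so Fubini supplies its
  -- measurability as well as its integrability.
  have hKint : IntegrableOn K (Set.Icc (-1) 1) :=
    (integrable_indicator_iff measurableSet_Icc).mp (hprod.integral_prod_left.congr hslice)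
  refine ⟨(intervalIntegrable_iff_integrableOn_Icc_of_le (by norm_num)).mpr hKint, ?_⟩
  rw [shearletTransform_eq s ha, integral_slope hint, Measure.volume_eq_prod,
    integral_prod _ hprod, integral_congr_ae hslice, integral_indicator measurableSet_Icc,
    intervalIntegral.integral_of_le (by norm_num), integral_Icc_eq_integral_Ioc]

end Horizontal

/-! ### The vertical formula by exchange of coordinates -/

section Vertical

theorem swapCoord_swapCoord (z : Plane) : swapCoord (swapCoord z) = z := by
  ext i
  fin_cases i <;> simp [swapCoord]

theorem swapL2_coe (g : L2Plane) : (swapL2 g : Plane → ℂ) =ᵐ[volume] g ∘ swapCoord :=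
  MemLp.coeFn_toLp _

theorem swapL2_comp_swapCoord (g : L2Plane) :
    (swapL2 g : Plane → ℂ) ∘ swapCoord =ᵐ[volume] g := by
  filter_upwards [measurePreserving_swapCoord.quasiMeasurePreserving.ae (swapL2_coe g)] with z hz
  simp only [Function.comp_apply] at hz ⊢
  rw [hz, swapCoord_swapCoord]

/-- Exchange of coordinates as a linear isometry. -/
noncomputable def swapIsometry : Plane ≃ₗᵢ[ℝ] Plane :=
  LinearIsometryEquiv.piLpCongrLeft 2 ℝ ℝ (Equiv.swap (0 : Fin 2) 1)

theorem swapIsometry_apply (z : Plane) : swapIsometry z = swapCoord z := by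
  ext i
  fin_cases i <;>
    simp [swapIsometry, swapCoord, LinearIsometryEquiv.piLpCongrLeft_apply,
      Equiv.piCongrLeft'_apply]

theorem integral_comp_swapCoord (h : Plane → ℂ) : ∫ z, h (swapCoord z) = ∫ z, h z := by
  simp_rw [← swapIsometry_apply]
  exact swapIsometry.measurePreserving.integral_comp' (f := swapIsometry.toMeasurableEquiv) h

/-- The exchange is orthogonal, so it commutes with 𝓕 on Schwartz functions; duality carries this to
L². -/
theorem fourier_swapL2 (g : L2Plane) : 𝓕 (swapL2 g) = swapL2 (𝓕 g) := by
  refine fourier_toLp_eq_of_dual _ _ fun k => ?_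
  let k' : 𝓢(Plane, ℂ) := SchwartzMap.compCLMOfContinuousLinearEquiv ℂ
    swapIsometry.toContinuousLinearEquiv k
  have hk' : ∀ z, k' z = k (swapCoord z) := fun z => by
    rw [← swapIsometry_apply]; rfl
  have hFk : ∀ z, (𝓕 k') z = (𝓕 k) (swapCoord z) := fun z => by
    rw [← swapIsometry_apply]
    exact Real.fourier_comp_linearIsometry swapIsometry k z
  have := integral_fourier_mul_Lp k' g
  simp only [hk', hFk] at this
  rw [← integral_comp_swapCoord, ← integral_comp_swapCoord (fun z => k z * _)]
  simpa only [Function.comp_apply, swapCoord_swapCoord] using this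

theorem vert_eq (ψ : L2Plane) : vert ψ = swapL2 ψ := by
  rw [vert, ← fourier_swapL2, FourierTransform.fourierInv_fourier_eq]

theorem cutoff_coe (D : Set Plane) (hD : MeasurableSet D) (g : L2Plane) :
    (cutoff D hD g : Plane → ℂ) =ᵐ[volume] D.indicator g :=
  MemLp.coeFn_toLp _

/-- The exchange maps one cone onto the other and commutes with 𝓕 and its inverse. -/
theorem projV_eq (F : L2Plane) : projV F = swapL2 (projH (swapL2 F)) := by
  have h : cutoff coneV measurableSet_coneV (𝓕 F)
      = swapL2 (cutoff coneH measurableSet_coneH (swapL2 (𝓕 F))) := by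
    apply Lp.ext
    filter_upwards [cutoff_coe coneV measurableSet_coneV (𝓕 F),
      swapL2_coe (cutoff coneH measurableSet_coneH (swapL2 (𝓕 F))),
      measurePreserving_swapCoord.quasiMeasurePreserving.ae
        (cutoff_coe coneH measurableSet_coneH (swapL2 (𝓕 F))),
      swapL2_comp_swapCoord (𝓕 F)] with z h1 h2 h3 h4
    rw [h1, h2, Function.comp_apply, h3]
    have hiff : swapCoord z ∈ coneH ↔ z ∈ coneV := by simp [coneH, coneV, swapCoord]
    by_cases hz : z ∈ coneV
    · rw [Set.indicator_of_mem hz, Set.indicator_of_mem (hiff.mpr hz)]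
      exact h4.symm
    · rw [Set.indicator_of_notMem hz, Set.indicator_of_notMem (fun h => hz (hiff.mp h))]
  rw [projV, projH, freqProj, freqProj, h, fourier_swapL2 F]
  set Q := cutoff coneH measurableSet_coneH (swapL2 (𝓕 F))
  have := fourier_swapL2 (𝓕⁻ Q)
  rw [FourierTransform.fourier_fourierInv_eq] at this
  rw [← this, FourierTransform.fourierInv_fourier_eq]

/-- The vertical shear and dilation matrices are the horizontal ones conjugated by the coordinate
permutation. -/
theorem shearletActV_swapCoord (b : Plane) (s : ℝ) {a : ℝ} (ha : a ≠ 0) (ψ : Plane → ℂ)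
    (z : Plane) : shearletActV (swapCoord b) s a ψ (swapCoord z)
      = shearletAct b s a (ψ ∘ swapCoord) z := by
  rw [shearletActV, shearletAct, dilA_inv_mul_shearN_inv s ha, dilAv_inv_mul_shearNv_inv s ha,
    toEuclideanLin_pair, toEuclideanLin_pair, Function.comp_apply]
  congr 2
  ext i
  fin_cases i <;> simp [swapCoord]; ring

theorem shearletTransformV_swap (ψ F : L2Plane) (b : Plane) (s : ℝ) {a : ℝ} (ha : a ≠ 0) :
    shearletTransformV (swapL2 ψ) (swapL2 F) (swapCoord b) s a = shearletTransform ψ F b s a := by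
  rw [shearletTransformV, shearletTransform, scalar, scalar, ← integral_comp_swapCoord]
  apply integral_congr_ae
  -- The generator is known only up to null sets, so its a.e. identity is pulled back along the
  -- affine map z ↦ A_a⁻¹N_s⁻¹(z - b).
  have h := (quasiMeasurePreserving_continuousLinearEquiv (shearletEquiv s ha)).comp
    (measurePreserving_sub_right volume b).quasiMeasurePreserving
  filter_upwards [swapL2_comp_swapCoord F, h.ae (swapL2_comp_swapCoord ψ)] with z h1 h2
  rw [shearletActV_swapCoord b s ha, shearletAct_eq s ha, shearletAct_eq s ha]
  simp only [Function.comp_apply] at h1 h2 ⊢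
  rw [h1, h2]

theorem radonV_eq (f : Plane → ℂ) (v : ℝ) : radonV f v = radonH (f ∘ swapCoord) v := by
  ext t
  simp [radonV, radonH, swapCoord]

theorem swapL2_toLp {f : Plane → ℂ} (hf : MemLp f 2) :
    swapL2 (hf.toLp f)
      = (hf.comp_measurePreserving measurePreserving_swapCoord).toLp (f ∘ swapCoord) := by
  apply Lp.ext
  filter_upwards [swapL2_coe (hf.toLp f),
    (hf.comp_measurePreserving measurePreserving_swapCoord).coeFn_toLp,
    measurePreserving_swapCoord.quasiMeasurePreserving.ae hf.coeFn_toLp] with z h1 h2 h3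
  rw [h1, h2, Function.comp_apply, h3, Function.comp_apply]

end Vertical

/-- The second-moment condition says exactly that |τ| 𝓕ψ₁ is in L², so Plancherel inverts it. -/
theorem exists_fourier_eq_abs_mul (ψ₁ : L2Line)
    (h : Integrable fun τ : ℝ => |τ| ^ 2 * ‖(𝓕 ψ₁ : L2Line) τ‖ ^ 2) :
    ∃ χ₁ : L2Line, ∀ᵐ τ : ℝ, (𝓕 χ₁ : L2Line) τ = ((|τ| : ℝ) : ℂ) * (𝓕 ψ₁ : L2Line) τ := by
  have hm : AEStronglyMeasurable (fun τ : ℝ => ((|τ| : ℝ) : ℂ) * (𝓕 ψ₁ : L2Line) τ) :=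
    (by fun_prop : Continuous fun τ : ℝ => ((|τ| : ℝ) : ℂ)).aestronglyMeasurable.mul
      (Lp.aestronglyMeasurable _)
  have hL : MemLp (fun τ : ℝ => ((|τ| : ℝ) : ℂ) * (𝓕 ψ₁ : L2Line) τ) 2 := by
    rw [memLp_two_iff_integrable_sq_norm hm]
    refine h.congr (Filter.Eventually.of_forall fun τ => ?_)
    simp [mul_pow]
  refine ⟨𝓕⁻ (hL.toLp _), ?_⟩
  rw [FourierTransform.fourier_fourierInv_eq]
  exact hL.coeFn_toLp

end ConeShearlet

open ConeShearlet in
theorem proposition3p1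
    -- the generating functions `ψ₁, ψ₂ ∈ L²(ℝ)` and `ψ ∈ L²(ℝ²)`
    (ψ₁ ψ₂ : L2Line) (ψ : L2Plane)
    (hψ : ∀ᵐ ξ : Plane, (𝓕 ψ : L2Plane) ξ
      = (𝓕 ψ₁ : L2Line) (ξ 0) * (𝓕 ψ₂ : L2Line) (ξ 1 / ξ 0))
    (hψ₁ : Integrable fun τ : ℝ => ‖(𝓕 ψ₁ : L2Line) τ‖ ^ 2 / |τ|)
    (hψ₁_pos : 0 < ∫ τ : ℝ, ‖(𝓕 ψ₁ : L2Line) τ‖ ^ 2 / |τ|)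
    (hψ₁_one : Integrable fun τ : ℝ => |τ| * ‖(𝓕 ψ₁ : L2Line) τ‖ ^ 2)
    (hψ₁_two : Integrable fun τ : ℝ => |τ| ^ 2 * ‖(𝓕 ψ₁ : L2Line) τ‖ ^ 2) :
    -- the (unique) `χ₁ ∈ L²(ℝ)` with `𝓕 χ₁ (τ) = |τ| 𝓕 ψ₁ (τ)`
    ∃ χ₁ : L2Line,
      (∀ᵐ τ : ℝ, (𝓕 χ₁ : L2Line) τ = ((|τ| : ℝ) : ℂ) * (𝓕 ψ₁ : L2Line) τ) ∧
      ∀ (f : Plane → ℂ) (_ : Integrable f) (hf : MemLp f 2),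
        -- the one-dimensional scalar products make sense for almost every `v`
        (∀ᵐ v : ℝ, MemLp (radonH f v) 2) ∧
        (∀ᵐ v : ℝ, MemLp (radonV f v) 2) ∧
        ∀ x y s a : ℝ, a ≠ 0 →
          (IntervalIntegrable (fun v : ℝ =>
              waveletTransform χ₁ (radonH f v) (x + v * y) a *
                conj ((𝓕 ψ₂ : L2Line) ((v - s) / |a| ^ (1 / 2 : ℝ)))) volume (-1) 1 ∧
            shearletTransform ψ (projH (hf.toLp f)) !₂[x, y] s a =
              ((|a| ^ (-(3 / 4) : ℝ) : ℝ) : ℂ) *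
                ∫ v in (-1 : ℝ)..1,
                  waveletTransform χ₁ (radonH f v) (x + v * y) a *
                    conj ((𝓕 ψ₂ : L2Line) ((v - s) / |a| ^ (1 / 2 : ℝ)))) ∧
          (IntervalIntegrable (fun v : ℝ =>
              waveletTransform χ₁ (radonV f v) (v * x + y) a *
                conj ((𝓕 ψ₂ : L2Line) ((v - s) / |a| ^ (1 / 2 : ℝ)))) volume (-1) 1 ∧
            shearletTransformV (vert ψ) (projV (hf.toLp f)) !₂[x, y] s a =
              ((|a| ^ (-(3 / 4) : ℝ) : ℝ) : ℂ) *
                ∫ v in (-1 : ℝ)..1,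
                  waveletTransform χ₁ (radonV f v) (v * x + y) a *
                    conj ((𝓕 ψ₂ : L2Line) ((v - s) / |a| ^ (1 / 2 : ℝ)))) := by
  obtain ⟨χ₁, hχ₁⟩ := exists_fourier_eq_abs_mul ψ₁ hψ₁_two
  refine ⟨χ₁, hχ₁, fun f hf1 hf => ?_⟩
  have hf1' : Integrable (f ∘ swapCoord) :=
    measurePreserving_swapCoord.integrable_comp_of_integrable hf1
  have hf' := hf.comp_measurePreserving measurePreserving_swapCoord
  refine ⟨ae_memLp_radonH hf1 hf, ?_, fun x y s a ha => ⟨?_, ?_⟩⟩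
  · simp only [radonV_eq]
    exact ae_memLp_radonH hf1' hf'
  · exact shearletTransform_projH hψ hχ₁ hf1 hf !₂[x, y] s ha
  -- The horizontal formula is applied to the exchanged function at the exchanged point, where its
  -- offset y + vx is the vertical one.
  · have h := shearletTransform_projH hψ hχ₁ hf1' hf' !₂[y, x] s ha
    have hswap : (!₂[x, y] : Plane) = swapCoord !₂[y, x] := rfl
    rw [vert_eq, projV_eq, swapL2_toLp, hswap, shearletTransformV_swap _ _ _ _ ha]
    have hpt : ∀ v : ℝ, v * x + y = (!₂[y, x] : Plane) 0 + v * (!₂[y, x] : Plane) 1 :=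
      fun v => add_comm _ _
    simp only [radonV_eq, hpt]
    exact h
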